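/- All spaces are path-connected. For a metric space $X$ and $k\ge 1$, let $\mathcal B_k(X)$ be the set of Borel probability measures $\mu=\sum_{i=1}^k a_i\delta_{x_i}$ on $X$ (with $a_i\ge 0$, $\sum_i a_i=1$), with the topology of the Lévy–Prokhorov metric, and $\mathrm{supp}(\mu)=\{x\in X\mid \mu(\{x\})>0\}$. For a map $p\colon E\to B$ with $E$ a metric space, let $E_k(p)=\{\mu\in\mathcal B_k(E)\mid \mathrm{supp}(\mu)\subset p^{-1}(b)\text{ for some }b\in B\}$, and let $\mathcal B_k(p)\colon E_k(p)\to B$ send $\mu$ to that $b$. The distributional sectional category $\mathrm{dsecat}(p)$ is the smallest $n\ge 0$ such that $\mathcal B_{n+1}(p)$ has a continuous section ($\infty$ if there is none). Path spaces carry the uniform metric on paths $I=[0,1]\to X$. For a metric space $X$ with base point $x_0$, $\mathrm{dcat}(X)=\mathrm{dsecat}\big(\{\phi\in X^I\mid\phi(1)=x_0\}\to X,\ \phi\mapsto\phi(0)\big)$, and for $r\ge 2$, $\mathrm{dTC}_r(X)=\mathrm{dsecat}\big(X^I\to X^r,\ \phi\mapsto(\phi(0),\phi(\tfrac1{r-1}),\dots,\phi(\tfrac{r-2}{r-1}),\phi(1))\big)$.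 For $p\colon E\to B$ with $E$ a metric space, let $E^r_B=\{(e_1,\dots,e_r)\in E^r\mid p(e_i)=p(e_j)\ \forall i,j\}$ and $E^I_B=\{\gamma\in E^I\mid p\circ\gamma\text{ is constant}\}$; $\mathrm{dTC}_r[p\colon E\to B]$ is the smallest $n\ge 0$ for which there is a continuous map $s\colon E^r_B\to\mathcal B_{n+1}(E^I_B)$ such that every $\gamma\in\mathrm{supp}(s(e_1,\dots,e_r))$ satisfies $\gamma(\tfrac{i-1}{r-1})=e_i$ for $1\le i\le r$ ($\infty$ if there is none). **Proposition.** Let $G$ be a path-connected topological group whose topology is given by a metric, and let $p\colon E\to B$ be a (locally trivial) principal $G$-bundle, where $E$ is a path-connected metric space and $B$ is a path-connected topological space. Then for every $r\ge 2$ and every choice of base point in $G^{r-1}$, $$\mathrm{dTC}_r[p\colon E\to B]=\mathrm{dTC}_r(G)=\mathrm{dcat}(G^{r-1}).$$ -/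

import Mathlib

open MeasureTheory unitInterval

noncomputable section

namespace DistributionalComplexity

/-- The space of Borel probability measures on a metric space `X`, with the Lévy–Prokhorov
metric. The σ-algebra is always the Borel σ-algebra of `X`. -/
abbrev BorelProb (X : Type*) [MetricSpace X] : Type _ :=
  LevyProkhorov (@ProbabilityMeasure X (borel X))

instance instMetricSpaceBorelProb (X : Type*) [MetricSpace X] : MetricSpace (BorelProb X) :=
  @LevyProkhorov.levyProkhorovDist_metricSpace_probabilityMeasure X (borel X) _
    (@BorelSpace.opensMeasurable X _ (borel X) (@BorelSpace.mk X _ (borel X) rfl))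
    (@BorelSpace.mk X _ (borel X) rfl)

/-- The underlying measure of an element of `BorelProb X`. -/
def BorelProb.measure {X : Type*} [MetricSpace X] (μ : BorelProb X) : @Measure X (borel X) :=
  μ.toMeasure.1

/-- `𝓑ₖ(X)`: the probability measures on `X` concentrated on a set of at most `k` points, with the
topology induced by the Lévy–Prokhorov metric. -/
def FinProb (k : ℕ) (X : Type*) [MetricSpace X] : Set (BorelProb X) :=
  {μ | ∃ S : Finset X, S.card ≤ k ∧ BorelProb.measure μ (↑S : Set X)ᶜ = 0}

/-- The support of a finitely supported measure: the finite set of its atoms. -/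
def FinProb.supp {k : ℕ} {X : Type*} [MetricSpace X] (μ : FinProb k X) : Set X :=
  {x | BorelProb.measure μ.1 {x} ≠ 0}

/-- The support of a finitely supported probability measure is not empty. -/
theorem FinProb.supp_nonempty {k : ℕ} {X : Type*} [MetricSpace X] (μ : FinProb k X) :
    (FinProb.supp μ).Nonempty := by
  obtain ⟨S, -, hS⟩ := μ.2
  by_contra h
  rw [Set.not_nonempty_iff_eq_empty] at h
  have h0 : ∀ x, BorelProb.measure μ.1 {x} = 0 := by
    intro x
    by_contra hx
    have hx' : x ∈ FinProb.supp μ := hx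
    rw [h] at hx'
    exact hx'
  have hS' : BorelProb.measure μ.1 (↑S : Set X) = 0 := by
    have e : (↑S : Set X) = ⋃ x ∈ (↑S : Set X), {x} := (Set.biUnion_of_singleton _).symm
    rw [e]
    exact (measure_biUnion_null_iff S.countable_toSet).2 fun x _ => h0 x
  have h1 : BorelProb.measure μ.1 Set.univ = 1 := μ.1.toMeasure.2.measure_univ
  have h2 := measure_union_le (μ := BorelProb.measure μ.1) (↑S : Set X) (↑S : Set X)ᶜ
  rw [Set.union_compl_self, h1, hS', hS] at h2
  simp at h2

/-- `Eₖ(p)`: the measures in `𝓑ₖ(E)` whose support lies in a single fibre of `p : E → B`. -/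
def FibProb (k : ℕ) {E B : Type*} [MetricSpace E] (p : E → B) : Set (FinProb k E) :=
  {μ | ∃ b : B, FinProb.supp μ ⊆ p ⁻¹' {b}}

/-- The map `𝓑ₖ(p) : Eₖ(p) → B`, sending a measure to the point over which it is supported. -/
def FibProb.proj {k : ℕ} {E B : Type*} [MetricSpace E] {p : E → B} (μ : FibProb k p) : B :=
  μ.2.choose

theorem FibProb.proj_eq_iff {k : ℕ} {E B : Type*} [MetricSpace E] {p : E → B}
    (μ : FibProb k p) (b : B) : FibProb.proj μ = b ↔ FinProb.supp μ.1 ⊆ p ⁻¹' {b} := by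
  have h : FinProb.supp μ.1 ⊆ p ⁻¹' {FibProb.proj μ} := μ.2.choose_spec
  constructor
  · rintro rfl
    exact h
  · intro h'
    obtain ⟨x, hx⟩ := FinProb.supp_nonempty μ.1
    have h1 : p x = FibProb.proj μ := h hx
    have h2 : p x = b := h' hx
    rw [← h1, h2]

/-- The distributional sectional category of `p : E → B`: the smallest `n` such that
`𝓑ₙ₊₁(p) : Eₙ₊₁(p) → B` has a continuous section, and `⊤` if there is no such `n`. -/
def dsecat {E B : Type*} [MetricSpace E] [TopologicalSpace B] (p : E → B) : ℕ∞ :=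
  ⨅ (n : ℕ) (_ : ∃ s : C(B, FibProb (n + 1) p), ∀ b, FibProb.proj (s b) = b), (n : ℕ∞)

/-- The space `P₀(X)` of paths in `X` that end at the base point `x₀`. -/
def basedPaths (X : Type*) [TopologicalSpace X] (x₀ : X) : Set C(I, X) :=
  {φ | φ 1 = x₀}

/-- The distributional category of the pointed metric space `(X, x₀)`: the distributional
sectional category of the evaluation `P₀(X) → X`, `φ ↦ φ(0)`. -/
def dcat (X : Type*) [MetricSpace X] (x₀ : X) : ℕ∞ :=
  dsecat (fun φ : basedPaths X x₀ => φ.1 0)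

/-- The time `i / (r - 1)`, for `i = 0, …, r - 1`. -/
def node (r : ℕ) (i : Fin r) : I :=
  ⟨(i : ℝ) / ((r : ℝ) - 1), by
    have h : (i : ℝ) ≤ (r : ℝ) - 1 := by
      have : ((i : ℕ) : ℝ) + 1 ≤ (r : ℝ) := by exact_mod_cast i.2
      linarith
    have h0 : (0 : ℝ) ≤ (i : ℝ) := Nat.cast_nonneg _
    exact unitInterval.div_mem h0 (h0.trans h) h⟩

/-- The path fibration `π_r : X^I → X^r`, evaluating a path at the times `i / (r - 1)`. -/
def pathEval (r : ℕ) (X : Type*) [TopologicalSpace X] (φ : C(I, X)) : Fin r → X :=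
  fun i => φ (node r i)

/-- The `r`-th sequential distributional complexity of a metric space `X`. -/
def dTC (r : ℕ) (X : Type*) [MetricSpace X] : ℕ∞ :=
  dsecat (pathEval r X)

/-- `E^I_B`: the paths in `E` that lie in a single fibre of `p`. As a space it carries the
compact-open topology, given by the uniform metric. -/
def fibPaths {E B : Type*} [TopologicalSpace E] (p : E → B) : Set C(I, E) :=
  {γ | ∃ b : B, ∀ t, p (γ t) = b}

/-- The fibre product `E^r_B`, a subspace of `E^r`. -/
def fibProduct (r : ℕ) {E B : Type*} (p : E → B) : Set (Fin r → E) :=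
  {e | ∀ i j, p (e i) = p (e j)}

/-- `E^I_B(e₁, …, e_r)`: the paths in `E^I_B` passing through the given points at the times
`i / (r - 1)`. -/
def fibPathsThrough {r : ℕ} {E B : Type*} [TopologicalSpace E] (p : E → B) (e : Fin r → E) :
    Set (fibPaths p) :=
  {γ | ∀ i, γ.1 (node r i) = e i}

/-- An `r`-th sequential parametrized `k`-distributed navigation algorithm for `p`: a continuous
map `s : E^r_B → 𝓑ₖ(E^I_B)` with `s(e) ∈ 𝓑ₖ(E^I_B(e))` for all `e ∈ E^r_B`. -/
structure NavigationAlgorithm (r k : ℕ) {E B : Type*} [MetricSpace E] (p : E → B) where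
  /-- The underlying map. -/
  toMap : C(fibProduct r p, FinProb k (fibPaths p))
  supp_subset : ∀ e : fibProduct r p, FinProb.supp (toMap e) ⊆ fibPathsThrough p e.1

/-- The `r`-th sequential parametrized distributional complexity of `p : E → B`: the smallest `n`
such that `p` has an `r`-th sequential parametrized `(n+1)`-distributed navigation algorithm, and
`⊤` if there is no such `n`. -/
def paramDTC (r : ℕ) {E B : Type*} [MetricSpace E] (p : E → B) : ℕ∞ :=
  ⨅ (n : ℕ) (_ : Nonempty (NavigationAlgorithm r (n + 1) p)), (n : ℕ∞)

/-- `p : E → B` is a principal `G`-bundle, for a continuous right action of `G` on `E` (a left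
action of the opposite group): the action preserves the fibres of `p`, and every point of `B` has
an open neighbourhood `U` with a homeomorphism `p⁻¹(U) ≅ U × G` over `U` that is equivariant for
right translation on the factor `G`. -/
structure IsPrincipalBundle (G : Type*) {E B : Type*} [TopologicalSpace G] [Group G]
    [TopologicalSpace E] [TopologicalSpace B] [MulAction Gᵐᵒᵖ E] (p : E → B) : Prop where
  continuous_action : ContinuousSMul Gᵐᵒᵖ E
  proj_smul : ∀ (g : G) (x : E), p (MulOpposite.op g • x) = p x
  locally_trivial : ∀ b : B, ∃ φ : Bundle.Trivialization G p, b ∈ φ.baseSet ∧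
    ∀ (x : E) (g : G), p x ∈ φ.baseSet → (φ (MulOpposite.op g • x)).2 = (φ x).2 * g

end DistributionalComplexity

end

/-! Each invariant asks for a continuous family of measures with at most `n + 1` atoms, supported on
paths subject to pointwise constraints. Pushforward along a fibrewise map that is jointly continuous
on the allowed pairs (parameter, path) carries one such family to another without adding atoms
(`FinProb.exists_transport`, resting on `FinProb.continuous_map`). It remains to exhibit maps of
paths.

For the bundle, translation between points of a fibre is continuous: a vertical path becomes a path
in `G` by measuring it from a fixed point, and a path in `G` becomes vertical by acting on the first
prescribed point.

For `G` itself, a path starting at 1 and visiting the `h i` contracts every `h i` to 1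
simultaneously. Conversely, contracting the increments `(g j)⁻¹ * g (j + 1)` one after another
builds a path through the `g i`. Fixed paths from 1 to the `x₀ i` correct the base point. -/

open Filter Topology

/-! ### Lévy–Prokhorov estimate for images of finitely supported measures -/

namespace MeasureTheory

/-- Any function is a.e. measurable for a measure concentrated on a finite set. -/
theorem aemeasurable_of_measure_compl_finset {X Z : Type*} [MeasurableSpace X]
    [MeasurableSingletonClass X] [MeasurableSpace Z] {μ : Measure X} {S : Finset X}
    (hS : μ (↑S : Set X)ᶜ = 0) (F : X → Z) : AEMeasurable F μ := by
  classical
  rcases isEmpty_or_nonempty X with _ | ⟨⟨a⟩⟩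
  · exact (measurable_of_empty F).aemeasurable
  refine ⟨(↑S : Set X).piecewise F fun _ => F a, fun t ht => ?_, ?_⟩
  · rw [Set.piecewise_preimage]
    exact (S.finite_toSet.subset Set.inter_subset_right).measurableSet.union
      ((measurable_const ht).diff S.measurableSet)
  · filter_upwards [show ∀ᵐ x ∂μ, x ∈ (↑S : Set X) from hS] with x hx
    simp [hx]

/-- If two probability measures are close and concentrated on finite sets `S`, `T`, and two maps
`F`, `G` take nearby points of `S` and `T` to nearby points, then the images are close. -/
theorem levyProkhorovEDist_map_le {X Z : Type*} [MetricSpace X] [MeasurableSpace X] [BorelSpace X]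
    [MetricSpace Z] [MeasurableSpace Z] [BorelSpace Z] {μ ν : Measure X}
    [IsProbabilityMeasure μ] [IsProbabilityMeasure ν] {F G : X → Z} {S T : Finset X}
    (hS : μ (↑S : Set X)ᶜ = 0) (hT : ν (↑T : Set X)ᶜ = 0) {δ ε : ℝ} (hδ : 0 < δ) (hδε : δ ≤ ε)
    (hμν : levyProkhorovEDist μ ν < ENNReal.ofReal δ)
    (hFG : ∀ x ∈ S, ∀ y ∈ T, dist x y < δ → dist (F x) (G y) < ε) :
    levyProkhorovEDist (μ.map F) (ν.map G) ≤ ENNReal.ofReal ε := by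
  have hF : AEMeasurable F μ := aemeasurable_of_measure_compl_finset hS F
  have hG : AEMeasurable G ν := aemeasurable_of_measure_compl_finset hT G
  have := Measure.isProbabilityMeasure_map hF
  have := Measure.isProbabilityMeasure_map hG
  refine levyProkhorovEDist_le_of_forall_le _ _ _ fun η B hη hη' hB => ?_
  rw [Measure.map_apply_of_aemeasurable hF hB,
    Measure.map_apply_of_aemeasurable hG Metric.isOpen_thickening.measurableSet]
  have hε : 0 < ε := hδ.trans_le hδε
  have hεη : ε ≤ η.toReal := (ENNReal.ofReal_le_iff_le_toReal hη'.ne).1 hη.le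
  -- Cutting down to the finite set `S` gives a measurable set, although `F` need not be measurable.
  calc μ (F ⁻¹' B) ≤ μ (F ⁻¹' B ∩ ↑S) :=
        (measure_inter_conull' (measure_mono_null (by intro x hx; exact hx.2) hS)).ge
    _ ≤ ν (Metric.thickening (ENNReal.ofReal δ).toReal (F ⁻¹' B ∩ ↑S)) + ENNReal.ofReal δ :=
        left_measure_le_of_levyProkhorovEDist_lt hμν
          (S.finite_toSet.subset Set.inter_subset_right).measurableSet
    _ ≤ ν (Metric.thickening δ (F ⁻¹' B ∩ ↑S) ∩ ↑T) + ENNReal.ofReal δ := by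
        rw [ENNReal.toReal_ofReal hδ.le]
        refine add_le_add_left ?_ _
        exact (measure_inter_conull' (measure_mono_null (by intro x hx; exact hx.2) hT)).ge
    _ ≤ ν (G ⁻¹' Metric.thickening η.toReal B) + η := by
        gcongr
        · rintro y ⟨hy, hyT⟩
          obtain ⟨x, ⟨hxB, hxS⟩, hxy⟩ := Metric.mem_thickening_iff.1 hy
          refine Metric.mem_thickening_iff.2 ⟨F x, hxB, ?_⟩
          rw [dist_comm]
          exact (hFG x hxS y hyT (by rwa [dist_comm])).trans_le hεη
        · exact (ENNReal.ofReal_le_ofReal hδε).trans hη.le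

end MeasureTheory

/-! ### Pushforward of families of finitely supported measures -/

noncomputable section

namespace DistributionalComplexity

/-- The non-atoms in a finite carrier form a finite union of null points, so they can be discarded.
-/
theorem FinProb.exists_finset {k : ℕ} {X : Type*} [MetricSpace X] (μ : FinProb k X) :
    ∃ S : Finset X, S.card ≤ k ∧ (↑S : Set X) = FinProb.supp μ ∧
      BorelProb.measure μ.1 (↑S : Set X)ᶜ = 0 := by
  classical
  obtain ⟨S, hk, hS⟩ := μ.2
  let _ := borel X
  have : BorelSpace X := ⟨rfl⟩
  have hsub : FinProb.supp μ ⊆ ↑S := fun x hx => by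
    by_contra hxS
    exact hx (measure_mono_null (Set.singleton_subset_iff.2 hxS) hS)
  refine ⟨S.filter (· ∈ FinProb.supp μ), (Finset.card_filter_le _ _).trans hk, ?_, ?_⟩
  · ext x
    simpa using fun hx => hsub hx
  · refine measure_mono_null (t := (↑S : Set X)ᶜ ∪ ⋃ x ∈ S.filter (· ∉ FinProb.supp μ), {x})
      (fun x hx => ?_) (measure_union_null hS
        ((measure_biUnion_null_iff (Finset.countable_toSet _)).2 fun x hx => ?_))
    · by_cases hxS : x ∈ S
      · right
        simp only [Finset.coe_filter, Set.mem_compl_iff, Set.mem_ofPred_eq, not_and] at hx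
        simp [hxS, hx hxS]
      · exact Or.inl hxS
    · simpa [FinProb.supp] using (Finset.mem_filter.1 hx).2

/-- The image of a finitely supported probability measure under an arbitrary map. -/
def FinProb.map {k : ℕ} {X Z : Type*} [MetricSpace X] [MetricSpace Z] (F : X → Z)
    (μ : FinProb k X) : FinProb k Z :=
  letI := borel X
  letI := borel Z
  haveI : BorelSpace X := ⟨rfl⟩
  haveI : BorelSpace Z := ⟨rfl⟩
  have hF : AEMeasurable F (BorelProb.measure μ.1) :=
    aemeasurable_of_measure_compl_finset μ.2.choose_spec.2 F
  ⟨.ofMeasure (μ.1.toMeasure.map hF), by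
    classical
    obtain ⟨S, hk, hS⟩ := μ.2
    refine ⟨S.image F, Finset.card_image_le.trans hk, ?_⟩
    change (BorelProb.measure μ.1).map F _ = 0
    rw [Measure.map_apply_of_aemeasurable hF (Finset.measurableSet _).compl]
    refine measure_mono_null (t := (↑S : Set X)ᶜ) (fun x hx hxS => hx ?_) hS
    exact Finset.mem_coe.2 (Finset.mem_image_of_mem F hxS)⟩

theorem FinProb.measure_map {k : ℕ} {X Z : Type*} [MetricSpace X] [MetricSpace Z] (F : X → Z)
    (μ : FinProb k X) : BorelProb.measure (FinProb.map F μ).1 =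
      @Measure.map X Z (borel X) (borel Z) F (BorelProb.measure μ.1) :=
  rfl

theorem FinProb.supp_map_subset {k : ℕ} {X Z : Type*} [MetricSpace X] [MetricSpace Z] (F : X → Z)
    (μ : FinProb k X) : FinProb.supp (FinProb.map F μ) ⊆ F '' FinProb.supp μ := by
  let _ := borel X
  let _ := borel Z
  have : BorelSpace X := ⟨rfl⟩
  have : BorelSpace Z := ⟨rfl⟩
  obtain ⟨S, -, hSμ, hS⟩ := FinProb.exists_finset μ
  intro z hz
  by_contra hzF
  refine hz ?_
  rw [FinProb.measure_map, Measure.map_apply_of_aemeasurable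
    (aemeasurable_of_measure_compl_finset hS F) (measurableSet_singleton z)]
  refine measure_mono_null (t := (↑S : Set X)ᶜ) (fun x hx hxS => hzF ⟨x, ?_, hx⟩) hS
  rwa [← hSμ]

/-- A continuous family of finitely supported measures can be pushed forward along a family of maps
that is jointly continuous on a set containing the supports. -/
theorem FinProb.continuous_map {k : ℕ} {Y X Z : Type*} [TopologicalSpace Y] [MetricSpace X]
    [MetricSpace Z] {s : Y → FinProb k X} (hs : Continuous s) {F : Y → X → Z} {T : Set (Y × X)}
    (hF : ContinuousOn (fun q : Y × X => F q.1 q.2) T)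
    (hT : ∀ y, ∀ x ∈ FinProb.supp (s y), (y, x) ∈ T) :
    Continuous fun y => FinProb.map (F y) (s y) := by
  refine Continuous.subtype_mk (continuous_iff_continuousAt.2 fun y₀ => ?_) _
  let _ := borel X
  let _ := borel Z
  have : BorelSpace X := ⟨rfl⟩
  have : BorelSpace Z := ⟨rfl⟩
  obtain ⟨S, -, hSs, hS⟩ := FinProb.exists_finset (s y₀)
  refine EMetric.tendsto_nhds.2 fun η hη => ?_
  obtain ⟨ε, hε0, hε, hεη⟩ := ENNReal.lt_iff_exists_real_btwn.1 hη
  replace hε : 0 < ε := ENNReal.ofReal_pos.1 hε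
  -- The second coordinate of `q` is a radius. Since `S` is finite, one neighbourhood of `y₀` and
  -- one radius will serve all atoms.
  have hnear : ∀ x ∈ S, ∀ᶠ q : Y × ℝ in 𝓝 y₀ ×ˢ 𝓝[>] 0, ∀ x', dist x' x < q.2 →
      (q.1, x') ∈ T → dist (F q.1 x') (F y₀ x) < ε := by
    intro x hx
    have hx' : x ∈ FinProb.supp (s y₀) := by rwa [← hSs]
    have h := Metric.tendsto_nhds.1 (hF (y₀, x) (hT y₀ x hx')) ε hε
    rw [eventually_nhdsWithin_iff, nhds_prod_eq] at h
    obtain ⟨V, hV, W, hW, hVW⟩ := eventually_prod_iff.1 h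
    obtain ⟨ρ, hρ, hρW⟩ := Metric.eventually_nhds_iff.1 hW
    exact eventually_prod_iff.2 ⟨V, hV, (· ∈ Set.Ioc 0 ρ), Ioc_mem_nhdsGT hρ,
      fun hy _ hδ x' hx' => hVW hy (hρW (hx'.trans_le hδ.2))⟩
  obtain ⟨V, hV, D, hD, hVD⟩ := eventually_prod_iff.1 ((Filter.eventually_all_finset S).2 hnear)
  obtain ⟨δ, hδD, hδ, hδε⟩ := (hD.and (Ioc_mem_nhdsGT hε)).exists
  filter_upwards [hV, EMetric.tendsto_nhds.1 (continuous_subtype_val.comp hs).continuousAt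
    (ENNReal.ofReal δ) (ENNReal.ofReal_pos.2 hδ)] with y hyV hy
  obtain ⟨S', -, hSs', hS'⟩ := FinProb.exists_finset (s y)
  have : IsProbabilityMeasure (BorelProb.measure (s y).1) := (s y).1.toMeasure.2
  have : IsProbabilityMeasure (BorelProb.measure (s y₀).1) := (s y₀).1.toMeasure.2
  refine lt_of_le_of_lt ?_ hεη
  refine levyProkhorovEDist_map_le (F := F y) (G := F y₀) hS' hS hδ hδε hy
    fun x' hx' x hx hxx' => hVD hyV hδD x hx x' hxx' (hT y x' ?_)
  rwa [← hSs']

/-- Transport of a continuous family of finitely supported measures along a continuous map defined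
on a set containing the graph of the supports. -/
theorem FinProb.exists_transport {k : ℕ} {Y X Z : Type*} [TopologicalSpace Y] [MetricSpace X]
    [MetricSpace Z] (s : C(Y, FinProb k X)) {T : Set (Y × X)}
    (hT : ∀ y, ∀ x ∈ FinProb.supp (s y), (y, x) ∈ T) {F : T → Z} (hF : Continuous F)
    {R : Y → Set Z} (hR : ∀ q : T, F q ∈ R q.1.1) :
    ∃ s' : C(Y, FinProb k Z), ∀ y, FinProb.supp (s' y) ⊆ R y := by
  classical
  rcases isEmpty_or_nonempty Z with hZ | ⟨⟨z⟩⟩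
  · have hY : IsEmpty Y := ⟨fun y => by
      obtain ⟨x, hx⟩ := FinProb.supp_nonempty (s y)
      exact hZ.elim (F ⟨_, hT y x hx⟩)⟩
    exact ⟨⟨hY.elim, continuous_of_const fun y => hY.elim y⟩, fun y => hY.elim y⟩
  -- The value `z` off `T` is immaterial: no atom of `s y` lies there.
  let F' : Y → X → Z := fun y x => if h : (y, x) ∈ T then F ⟨(y, x), h⟩ else z
  have hF' : ∀ q : T, F' q.1.1 q.1.2 = F q := fun q => dif_pos q.2
  refine ⟨⟨fun y => FinProb.map (F' y) (s y), FinProb.continuous_map (s.continuous) (T := T) ?_ hT⟩,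
    fun y => ?_⟩
  · rw [continuousOn_iff_continuous_domRestrict]
    exact hF.congr fun q => (hF' q).symm
  · refine (FinProb.supp_map_subset _ _).trans ?_
    rintro _ ⟨x, hx, rfl⟩
    rw [hF' ⟨_, hT y x hx⟩]
    exact hR ⟨_, hT y x hx⟩

/-- A continuous section of `𝓑ₖ(p)` is a continuous family of measures supported in the fibres. -/
theorem exists_section_fibProb_iff {k : ℕ} {E B : Type*} [MetricSpace E] [TopologicalSpace B]
    (p : E → B) : (∃ s : C(B, FibProb k p), ∀ b, FibProb.proj (s b) = b) ↔
      ∃ s : C(B, FinProb k E), ∀ b, FinProb.supp (s b) ⊆ p ⁻¹' {b} := by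
  constructor
  · rintro ⟨s, hs⟩
    exact ⟨⟨fun b => (s b).1, continuous_subtype_val.comp s.continuous⟩,
      fun b => (FibProb.proj_eq_iff (s b) b).1 (hs b)⟩
  · rintro ⟨s, hs⟩
    exact ⟨⟨fun b => ⟨s b, b, hs b⟩, s.continuous.subtype_mk _⟩,
      fun b => (FibProb.proj_eq_iff _ b).2 (hs b)⟩

/-! ### The translation function of a principal bundle -/

section PrincipalBundle

variable {G E B : Type*} [TopologicalSpace G] [Group G] [TopologicalSpace E] [TopologicalSpace B]
  [MulAction Gᵐᵒᵖ E] {p : E → B}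

/-- The element of `G` that takes `x` to `y`, for two points of a fibre of a principal `G`-bundle. -/
def translation (G : Type*) {E : Type*} [Group G] [MulAction Gᵐᵒᵖ E] (x y : E) : G :=
  Classical.epsilon fun g => MulOpposite.op g • x = y

theorem IsPrincipalBundle.op_smul_eq_of_mem (hp : IsPrincipalBundle G p)
    {φ : Bundle.Trivialization G p}
    (hφ : ∀ (x : E) (g : G), p x ∈ φ.baseSet → (φ (MulOpposite.op g • x)).2 = (φ x).2 * g)
    {x y : E} (hx : p x ∈ φ.baseSet) (hxy : p x = p y) :
    MulOpposite.op ((φ x).2⁻¹ * (φ y).2) • x = y := by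
  refine φ.injOn (φ.mem_source.2 ?_) (φ.mem_source.2 (hxy ▸ hx)) (Prod.ext ?_ ?_)
  · rwa [hp.proj_smul]
  · exact (φ.coe_fst' (by rwa [hp.proj_smul])).trans
      (((hp.proj_smul _ _).trans hxy).trans (φ.coe_fst' (hxy ▸ hx)).symm)
  · exact (hφ _ _ hx).trans (mul_inv_cancel_left _ _)

theorem IsPrincipalBundle.op_translation_smul (hp : IsPrincipalBundle G p) {x y : E}
    (hxy : p x = p y) : MulOpposite.op (translation G x y) • x = y := by
  obtain ⟨φ, hx, hφ⟩ := hp.locally_trivial (p x)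
  exact Classical.epsilon_spec (p := fun g : G => MulOpposite.op g • x = y)
    ⟨_, hp.op_smul_eq_of_mem hφ hx hxy⟩

/-- The action is free, by cancellation in the `G`-coordinate of a trivialization, so the choice
made in `translation` is forced. -/
theorem IsPrincipalBundle.translation_op_smul (hp : IsPrincipalBundle G p) (x : E) (g : G) :
    translation G x (MulOpposite.op g • x) = g := by
  obtain ⟨φ, hx, hφ⟩ := hp.locally_trivial (p x)
  have h := hp.op_translation_smul (hp.proj_smul g x).symm
  have h' := congrArg (fun e => (φ e).2) h
  simpa only [hφ _ _ hx, mul_right_inj] using h'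

/-- Over a trivializing open set, translation is the continuous quotient `(φ x).2⁻¹ * (φ y).2` of
the `G`-coordinates. -/
theorem IsPrincipalBundle.continuousOn_translation [IsTopologicalGroup G]
    (hp : IsPrincipalBundle G p) :
    ContinuousOn (fun q : E × E => translation G q.1 q.2) {q | p q.1 = p q.2} := by
  rintro ⟨x, y⟩ hxy
  obtain ⟨φ, hx, hφ⟩ := hp.locally_trivial (p x)
  have hy : p y ∈ φ.baseSet := (show p x = p y from hxy) ▸ hx
  have hcont : ∀ z, p z ∈ φ.baseSet → ContinuousAt (fun z => (φ z).2) z := fun z hz =>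
    continuous_snd.continuousAt.comp (φ.continuousAt (φ.mem_source.2 hz))
  have h : ContinuousAt (fun q : E × E => (φ q.1).2⁻¹ * (φ q.2).2) (x, y) :=
    ((hcont x hx).comp (f := Prod.fst) (x := (x, y)) continuous_fst.continuousAt).inv.mul
      ((hcont y hy).comp (f := Prod.snd) (x := (x, y)) continuous_snd.continuousAt)
  have heq : ∀ q : E × E, p q.1 = p q.2 → p q.1 ∈ φ.baseSet →
      translation G q.1 q.2 = (φ q.1).2⁻¹ * (φ q.2).2 := by
    intro q hq hq1
    rw [← hp.translation_op_smul q.1 ((φ q.1).2⁻¹ * (φ q.2).2), hp.op_smul_eq_of_mem hφ hq1 hq]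
  refine h.continuousWithinAt.congr_of_eventuallyEq ?_ (heq _ hxy hx)
  have hnear : ∀ᶠ q : E × E in 𝓝 (x, y), p q.1 ∈ φ.baseSet := by
    filter_upwards [continuous_fst.continuousAt.preimage_mem_nhds
      (φ.open_source.mem_nhds (φ.mem_source.2 hx))] with q hq
    exact φ.mem_source.1 hq
  filter_upwards [self_mem_nhdsWithin, mem_nhdsWithin_of_mem_nhds hnear] with q hq hq1
  exact heq q hq hq1

end PrincipalBundle

/-! ### Vertical paths in the bundle versus paths in the group -/

theorem node_zero (n : ℕ) : node (n + 1) 0 = 0 := by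
  ext
  simp [node]

/-- A navigation algorithm for a principal `G`-bundle yields a section for the path fibration of
`G`, by restriction to a fibre. -/
theorem NavigationAlgorithm.exists_pathEval_section {G E B : Type*} [MetricSpace G] [Group G]
    [IsTopologicalGroup G] [MetricSpace E] [Nonempty E] [TopologicalSpace B] [MulAction Gᵐᵒᵖ E]
    {p : E → B} (hp : IsPrincipalBundle G p) {n k : ℕ} (N : NavigationAlgorithm (n + 1) k p) :
    ∃ s : C(Fin (n + 1) → G, FinProb k C(I, G)),
      ∀ g, FinProb.supp (s g) ⊆ pathEval (n + 1) G ⁻¹' {g} := by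
  have := hp.continuous_action
  obtain ⟨e⟩ := ‹Nonempty E›
  let c : C(Fin (n + 1) → G, fibProduct (n + 1) p) :=
    ⟨fun g => ⟨fun i => MulOpposite.op (g i) • e, fun i j => by simp only [hp.proj_smul]⟩,
      Continuous.subtype_mk (by fun_prop) _⟩
  let T : Set ((Fin (n + 1) → G) × fibPaths p) := {q | q.2 ∈ fibPathsThrough p (c q.1).1}
  have hT : ∀ (q : T) t, p e = p (q.1.2.1 t) := by
    intro q t
    obtain ⟨b, hb⟩ := q.1.2.2
    rw [hb t, ← hb (node (n + 1) 0), q.2 0]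
    exact (hp.proj_smul _ _).symm
  let F : C(T, C(I, G)) := ContinuousMap.curry ⟨fun q => translation G e (q.1.1.2.1 q.2),
    hp.continuousOn_translation.comp_continuous
      (f := fun q : T × I => (e, q.1.1.2.1 q.2)) (by fun_prop) fun q => hT q.1 q.2⟩
  refine FinProb.exists_transport (N.toMap.comp c) (T := T) (fun g γ hγ => N.supp_subset _ hγ)
    F.continuous fun q => ?_
  ext i
  change translation G e (q.1.2.1 (node (n + 1) i)) = q.1.1 i
  rw [q.2 i]
  exact hp.translation_op_smul e _

/-- A section for the path fibration of `G` yields a navigation algorithm for every principal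
`G`-bundle, by translation in the fibres. -/
theorem nonempty_navigationAlgorithm {G E B : Type*} [MetricSpace G] [Group G]
    [IsTopologicalGroup G] [MetricSpace E] [TopologicalSpace B] [MulAction Gᵐᵒᵖ E]
    {p : E → B} (hp : IsPrincipalBundle G p) {n k : ℕ}
    (s : C(Fin (n + 1) → G, FinProb k C(I, G)))
    (hs : ∀ g, FinProb.supp (s g) ⊆ pathEval (n + 1) G ⁻¹' {g}) :
    Nonempty (NavigationAlgorithm (n + 1) k p) := by
  have := hp.continuous_action
  let c : C(fibProduct (n + 1) p, Fin (n + 1) → G) :=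
    ⟨fun e i => translation G (e.1 0) (e.1 i), continuous_pi fun i =>
      hp.continuousOn_translation.comp_continuous
        (f := fun e : fibProduct (n + 1) p => (e.1 0, e.1 i))
        (((continuous_apply 0).comp continuous_subtype_val).prodMk
          ((continuous_apply i).comp continuous_subtype_val)) fun e => e.2 0 i⟩
  let T : Set (fibProduct (n + 1) p × C(I, G)) := {q | pathEval (n + 1) G q.2 = c q.1}
  let H : C(T, C(I, E)) := ContinuousMap.curry
    ⟨fun q => MulOpposite.op (q.1.1.2 q.2) • q.1.1.1.1 0, by
      have h0 : Continuous fun q : T × I => q.1.1.1.1 0 :=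
        (continuous_apply 0).comp (continuous_subtype_val.comp
          (continuous_fst.comp (continuous_subtype_val.comp continuous_fst)))
      have h1 : Continuous fun q : T × I => q.1.1.2 q.2 :=
        ContinuousEval.continuous_eval.comp
          ((continuous_snd.comp (continuous_subtype_val.comp continuous_fst)).prodMk continuous_snd)
      exact (MulOpposite.continuous_op.comp h1).smul h0⟩
  let F : T → fibPaths p := fun q => ⟨H q, p (q.1.1.1 0), fun t => hp.proj_smul _ _⟩
  obtain ⟨s', hs'⟩ := FinProb.exists_transport (s.comp c) (T := T) (fun e γ hγ => hs _ hγ)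
    (F := F) (H.continuous.subtype_mk _) (R := fun e => fibPathsThrough p e.1) fun q i => by
      change MulOpposite.op (q.1.2 (node (n + 1) i)) • q.1.1.1 0 = q.1.1.1 i
      have h : q.1.2 (node (n + 1) i) = translation G (q.1.1.1 0) (q.1.1.1 i) := congrFun q.2 i
      rw [h, hp.op_translation_smul (q.1.1.2 0 i)]
  exact ⟨⟨s', hs'⟩⟩

/-! ### Paths through `n + 1` points of `G` versus based paths in `G^n` -/

/-- A section for the path fibration `G^I → G^{n+1}` yields one for the based path fibration of
`G^n`. -/
theorem exists_basedPaths_section {G : Type*} [MetricSpace G] [Group G] [IsTopologicalGroup G]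
    [PathConnectedSpace G] {n k : ℕ} (x₀ : Fin n → G)
    (s : C(Fin (n + 1) → G, FinProb k C(I, G)))
    (hs : ∀ g, FinProb.supp (s g) ⊆ pathEval (n + 1) G ⁻¹' {g}) :
    ∃ s' : C(Fin n → G, FinProb k (basedPaths (Fin n → G) x₀)),
      ∀ h, FinProb.supp (s' h) ⊆ (fun φ : basedPaths (Fin n → G) x₀ => φ.1 0) ⁻¹' {h} := by
  let a : ∀ i, Path 1 (x₀ i) := fun i => PathConnectedSpace.somePath 1 (x₀ i)
  let c : C(Fin n → G, Fin (n + 1) → G) := ⟨fun h => Fin.cons 1 h, by fun_prop⟩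
  let T : Set ((Fin n → G) × C(I, G)) := {q | pathEval (n + 1) G q.2 = c q.1}
  have hT : ∀ (q : T) i, q.1.2 (node (n + 1) i) = (Fin.cons 1 q.1.1 : Fin (n + 1) → G) i :=
    fun q => congrFun q.2
  -- Coordinate `i` runs the path backwards from its visit to `h i` down to 1, while the factor `a
  -- i` moves the endpoint from 1 to `x₀ i`.
  let H : C(T, C(I, Fin n → G)) := ContinuousMap.curry
    ⟨fun q i => q.1.1.2 (σ q.2 * node (n + 1) i.succ) * a i q.2, by fun_prop⟩
  let F : T → basedPaths (Fin n → G) x₀ := fun q => ⟨H q, funext fun i => by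
    change q.1.2 (σ 1 * node (n + 1) i.succ) * a i 1 = x₀ i
    rw [symm_one, zero_mul, ← node_zero n, hT, Path.target, Fin.cons_zero, one_mul]⟩
  refine FinProb.exists_transport (s.comp c) (T := T) (fun h γ hγ => hs _ hγ)
    (F := F) (H.continuous.subtype_mk _) fun q => funext fun i => ?_
  change q.1.2 (σ 0 * node (n + 1) i.succ) * a i 0 = q.1.1 i
  rw [symm_zero, one_mul, hT, Path.source, Fin.cons_succ, mul_one]

/-- Factors from index `i` on are trivial, so the product freezes there. -/
theorem partialProd_eq_partialProd_min {M : Type*} [Monoid M] {n : ℕ} {f h : Fin n → M}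
    {i : Fin (n + 1)} (hlt : ∀ j : Fin n, j.castSucc < i → f j = h j)
    (hle : ∀ j : Fin n, i ≤ j.castSucc → f j = 1) (k : Fin (n + 1)) :
    Fin.partialProd f k = Fin.partialProd h (min k i) := by
  induction k using Fin.induction with
  | zero => simp
  | succ j ih =>
    rw [Fin.partialProd_succ, ih]
    rcases lt_or_ge j.castSucc i with hj | hj
    · rw [min_eq_left hj.le, min_eq_left (Fin.castSucc_lt_iff_succ_le.1 hj), hlt j hj,
        Fin.partialProd_succ]
    · rw [min_eq_right hj, min_eq_right (hj.trans (Fin.castSucc_lt_succ).le), hle j hj, mul_one]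

theorem continuous_partialProd {X M : Type*} [TopologicalSpace X] [TopologicalSpace M] [Monoid M]
    [ContinuousMul M] {n : ℕ} {f : X → Fin n → M} (hf : ∀ j, Continuous fun x => f x j)
    (k : Fin (n + 1)) : Continuous fun x => Fin.partialProd (f x) k := by
  induction k using Fin.induction with
  | zero => simpa using continuous_const
  | succ j ih => exact (ih.mul (hf j)).congr fun x => (Fin.partialProd_succ _ _).symm

/-- A section for the based path fibration of `G^n` yields one for the path fibration
`G^I → G^{n+1}`. -/
theorem exists_pathEval_section {G : Type*} [MetricSpace G] [Group G] [IsTopologicalGroup G]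
    [PathConnectedSpace G] {n k : ℕ} (hn : n ≠ 0) (x₀ : Fin n → G)
    (s : C(Fin n → G, FinProb k (basedPaths (Fin n → G) x₀)))
    (hs : ∀ h, FinProb.supp (s h) ⊆ (fun φ : basedPaths (Fin n → G) x₀ => φ.1 0) ⁻¹' {h}) :
    ∃ s' : C(Fin (n + 1) → G, FinProb k C(I, G)),
      ∀ g, FinProb.supp (s' g) ⊆ pathEval (n + 1) G ⁻¹' {g} := by
  let a : ∀ i, Path 1 (x₀ i) := fun i => PathConnectedSpace.somePath 1 (x₀ i)
  let c : C(Fin (n + 1) → G, Fin n → G) :=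
    ⟨fun g j => (g j.castSucc)⁻¹ * g j.succ, by fun_prop⟩
  let T : Set ((Fin (n + 1) → G) × basedPaths (Fin n → G) x₀) := {q | q.2.1 0 = c q.1}
  -- A clock for factor `j`: it rises from 0 to 1 between the consecutive nodes `j / n` and `(j + 1)
  -- / n` and is constant elsewhere.
  let u : Fin n → I → I := fun j t => Set.projIcc 0 1 zero_le_one (n * (t : ℝ) - j)
  have hu : ∀ j, Continuous (u j) := fun j => continuous_projIcc.comp (by fun_prop)
  have hu0 : ∀ i (j : Fin n), i ≤ j.castSucc → u j (node (n + 1) i) = 0 := by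
    intro i j hij
    refine Set.projIcc_of_le_left _ ?_
    have h : ((i : ℕ) : ℝ) ≤ j := by exact_mod_cast hij
    have hn' : (n : ℝ) ≠ 0 := by exact_mod_cast hn
    simp only [node, Nat.cast_add, Nat.cast_one, add_sub_cancel_right]
    rw [mul_div_cancel₀ _ hn']
    linarith
  have hu1 : ∀ i (j : Fin n), j.castSucc < i → u j (node (n + 1) i) = 1 := by
    intro i j hij
    refine Set.projIcc_of_right_le _ ?_
    have h : ((j : ℕ) : ℝ) + 1 ≤ (i : ℕ) := by exact_mod_cast hij
    have hn' : (n : ℝ) ≠ 0 := by exact_mod_cast hn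
    simp only [node, Nat.cast_add, Nat.cast_one, add_sub_cancel_right]
    rw [mul_div_cancel₀ _ hn']
    linarith
  -- As the clock runs from 0 to 1, factor `j` moves from `x₀ j * (x₀ j)⁻¹ = 1` to the increment `c
  -- g j`.
  let f : T → I → Fin n → G := fun q t j => q.1.2.1 (σ (u j t)) j * (a j (σ (u j t)))⁻¹
  have hf : Continuous fun q : T × I => Fin.partialProd (f q.1 q.2) (Fin.last n) :=
    continuous_partialProd (fun j => by fun_prop) _
  let F : C(T, C(I, G)) := ContinuousMap.curry
    ⟨fun q => q.1.1.1 0 * Fin.partialProd (f q.1 q.2) (Fin.last n), by fun_prop⟩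
  refine FinProb.exists_transport (s.comp c) (T := T) (fun g φ hφ => hs _ hφ)
    F.continuous fun q => funext fun i => ?_
  change q.1.1 0 * Fin.partialProd (f q (node (n + 1) i)) (Fin.last n) = q.1.1 i
  rw [partialProd_eq_partialProd_min (h := c q.1.1) (i := i), min_eq_right (Fin.le_last i)]
  -- The increments telescope: `g 0` times the first `i` of them is `g i`.
  · exact congrFun (Fin.partialProd_left_inv q.1.1) i
  · intro j hj
    have h : q.1.2.1 0 j = c q.1.1 j := congrFun q.2 j
    simp only [f, hu1 i j hj, symm_one, h, Path.source, inv_one, mul_one]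
  · intro j hj
    have h : q.1.2.1 1 j = x₀ j := congrFun q.1.2.2 j
    simp only [f, hu0 i j hj, symm_zero, h, Path.target, mul_inv_cancel]

theorem paramDTC_eq_dTC {G E B : Type*} [MetricSpace G] [Group G] [IsTopologicalGroup G]
    [MetricSpace E] [Nonempty E] [TopologicalSpace B] [MulAction Gᵐᵒᵖ E] {p : E → B}
    (hp : IsPrincipalBundle G p) (n : ℕ) : paramDTC (n + 1) p = dTC (n + 1) G := by
  have h : ∀ k, Nonempty (NavigationAlgorithm (n + 1) k p) ↔
      ∃ s : C(Fin (n + 1) → G, FibProb k (pathEval (n + 1) G)), ∀ g, FibProb.proj (s g) = g :=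
    fun k => by
      rw [exists_section_fibProb_iff]
      exact ⟨fun ⟨N⟩ => N.exists_pathEval_section hp,
        fun ⟨s, hs⟩ => nonempty_navigationAlgorithm hp s hs⟩
  simp only [paramDTC, dTC, dsecat, h]

theorem dTC_eq_dcat {G : Type*} [MetricSpace G] [Group G] [IsTopologicalGroup G]
    [PathConnectedSpace G] {n : ℕ} (hn : n ≠ 0) (x₀ : Fin n → G) :
    dTC (n + 1) G = dcat (Fin n → G) x₀ := by
  have h : ∀ k, (∃ s : C(Fin (n + 1) → G, FibProb k (pathEval (n + 1) G)),
      ∀ g, FibProb.proj (s g) = g) ↔ ∃ s : C(Fin n → G, FibProb k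
        (fun φ : basedPaths (Fin n → G) x₀ => φ.1 0)), ∀ h, FibProb.proj (s h) = h :=
    fun k => by
      rw [exists_section_fibProb_iff, exists_section_fibProb_iff]
      exact ⟨fun ⟨s, hs⟩ => exists_basedPaths_section x₀ s hs,
        fun ⟨s, hs⟩ => exists_pathEval_section hn x₀ s hs⟩
  simp only [dTC, dcat, dsecat, h]

end DistributionalComplexity

end

theorem mainTheorem5 {G E B : Type*}
    [MetricSpace G] [Group G] [IsTopologicalGroup G] [PathConnectedSpace G]
    [MetricSpace E] [PathConnectedSpace E] [TopologicalSpace B] [PathConnectedSpace B]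
    [MulAction Gᵐᵒᵖ E] (p : E → B) (hp : DistributionalComplexity.IsPrincipalBundle G p)
    (r : ℕ) (hr : 2 ≤ r) (x₀ : Fin (r - 1) → G) :
    DistributionalComplexity.paramDTC r p = DistributionalComplexity.dTC r G ∧
      DistributionalComplexity.dTC r G =
        DistributionalComplexity.dcat (Fin (r - 1) → G) x₀ := by
  obtain ⟨n, rfl⟩ := Nat.exists_eq_add_of_le' (one_le_two.trans hr)
  exact ⟨DistributionalComplexity.paramDTC_eq_dTC hp n,
    DistributionalComplexity.dTC_eq_dcat (by omega) x₀⟩
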